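/- **Notation.** For a complex matrix $M$, let $N(M)$ and $R(M)$ be its null space and range, $M^\star$ its conjugate transpose and $M^+$ its Moore-Penrose inverse. For a Hermitian matrix $H$ the generalized determinant $\det_+ H$ is the determinant of the linear map $H|_{R(H)} : R(H)\to R(H)$, with $\det_+ 0 = 1$. A positive semidefinite matrix that is partitioned into blocks, with square diagonal blocks $H_{11},\dots,H_{pp}$, is said to be of maximal rank (with respect to the partition) if $N(H)=N(H_{11})\oplus\dots\oplus N(H_{pp})$. **Theorem.** Let $A\in M_a(\mathbb C)$, $C\in M_c(\mathbb C)$, $E\in M_e(\mathbb C)$, let $B$ be a complex $a\times c$ matrix and $D$ a complex $c\times e$ matrix, and suppose that $$H[\alpha]=\begin{pmatrix}A&B\\B^\star&C\end{pmatrix}\quad\text{and}\quad H[\beta]=\begin{pmatrix}C&D\\D^\star&E\end{pmatrix}$$ are positive semidefinite and of maximal rank with respect to the partitions shown. For a complex $a\times e$ matrix $X$ put $$H_X=\begin{pmatrix}A&B&X\\B^\star&C&D\\X^\star&D^\star&E\end{pmatrix},$$ and let $\mathcal C$ be the set of all $X$ for which $H_X$ is positive semidefinite and of maximal rank with respect to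 this $3\times 3$ partition, i.e. $N(H_X)=N(A)\oplus N(C)\oplus N(E)$. Then $X=BC^+D$ is the unique maximizer of $X\mapsto\det_+H_X$ over $\mathcal C$. That is, a matrix $X$ satisfies $X\in\mathcal C$ and $\det_+H_Y\le\det_+H_X$ for all $Y\in\mathcal C$ if and only if $X=BC^+D$. -/

import Mathlib

open Matrix
open scoped ComplexOrder

namespace PSDCompletion

/-- The four Penrose equations: `P` is a Moore-Penrose inverse of `M`. -/
structure IsMoorePenrose {m n : Type*} [Fintype m] [Fintype n]
    (M : Matrix m n ℂ) (P : Matrix n m ℂ) : Prop where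
  mul_mul_self : M * P * M = M
  mul_mul_inv : P * M * P = P
  isHermitian_left : (M * P).IsHermitian
  isHermitian_right : (P * M).IsHermitian

/-- A Hermitian matrix has a Hermitian Moore-Penrose inverse. -/
theorem exists_isMoorePenrose_of_isHermitian {n : Type*} [Fintype n]
    {G : Matrix n n ℂ} (hG : G.IsHermitian) :
    ∃ P : Matrix n n ℂ, IsMoorePenrose G P ∧ P.IsHermitian := by
  classical
  obtain ⟨U, d, hU, h⟩ : ∃ (U : Matrix n n ℂ) (d : n → ℝ), Uᴴ * U = 1 ∧
      G = U * diagonal (fun i => (d i : ℂ)) * Uᴴ := by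
    refine ⟨hG.eigenvectorUnitary, hG.eigenvalues, ?_, ?_⟩
    · exact Unitary.coe_star_mul_self hG.eigenvectorUnitary
    · conv_lhs => rw [hG.spectral_theorem]
      rfl
  have key : ∀ X Y : Matrix n n ℂ, (U * X * Uᴴ) * (U * Y * Uᴴ) = U * (X * Y) * Uᴴ := by
    intro X Y
    calc (U * X * Uᴴ) * (U * Y * Uᴴ) = U * X * (Uᴴ * U) * Y * Uᴴ := by
          simp only [Matrix.mul_assoc]
      _ = U * (X * Y) * Uᴴ := by rw [hU]; simp only [Matrix.mul_assoc, Matrix.one_mul]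
  have herm : ∀ e : n → ℝ, (U * diagonal (fun i => (e i : ℂ)) * Uᴴ).IsHermitian := by
    intro e
    refine isHermitian_mul_mul_conjTranspose U ?_
    rw [Matrix.IsHermitian, diagonal_conjTranspose]
    congr 1
    ext i
    simp
  refine ⟨U * diagonal (fun i => (((d i)⁻¹ : ℝ) : ℂ)) * Uᴴ, ⟨?_, ?_, ?_, ?_⟩, herm _⟩
  · rw [h, key, key, diagonal_mul_diagonal, diagonal_mul_diagonal]
    congr 3
    ext i
    by_cases hi : d i = 0 <;> simp [hi]
  · rw [h, key, key, diagonal_mul_diagonal, diagonal_mul_diagonal]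
    congr 3
    ext i
    by_cases hi : d i = 0 <;> simp [hi]
  · rw [h, key, diagonal_mul_diagonal]
    simpa using herm (fun i => d i * (d i)⁻¹)
  · rw [h, key, diagonal_mul_diagonal]
    simpa using herm (fun i => (d i)⁻¹ * d i)

/-- Every complex matrix has a Moore-Penrose inverse. -/
theorem exists_isMoorePenrose {m n : Type*} [Fintype m] [Fintype n] (M : Matrix m n ℂ) :
    ∃ P : Matrix n m ℂ, IsMoorePenrose M P := by
  classical
  obtain ⟨Q, hQ, hQh⟩ := exists_isMoorePenrose_of_isHermitian (isHermitian_conjTranspose_mul_self M)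
  have h1 : M * (Q * (Mᴴ * M)) = M := by
    have h0 : (M - M * (Q * (Mᴴ * M)))ᴴ * (M - M * (Q * (Mᴴ * M))) = 0 := by
      have h2 : Mᴴ * (M - M * (Q * (Mᴴ * M))) = 0 := by
        have := hQ.mul_mul_self
        rw [Matrix.mul_sub, sub_eq_zero]
        simpa only [Matrix.mul_assoc] using this.symm
      rw [conjTranspose_sub, Matrix.sub_mul, h2, conjTranspose_mul, Matrix.mul_assoc, h2]
      simp
    exact (sub_eq_zero.mp (conjTranspose_mul_self_eq_zero.mp h0)).symm
  refine ⟨Q * Mᴴ, ⟨?_, ?_, ?_, ?_⟩⟩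
  · simpa only [Matrix.mul_assoc] using h1
  · have := congrArg (· * Mᴴ) hQ.mul_mul_inv
    simpa only [Matrix.mul_assoc] using this
  · rw [← Matrix.mul_assoc]
    exact isHermitian_mul_mul_conjTranspose M hQh
  · rw [Matrix.mul_assoc]
    exact hQ.isHermitian_right

/-- The Moore-Penrose inverse is unique. -/
theorem IsMoorePenrose.eq {m n : Type*} [Fintype m] [Fintype n] {M : Matrix m n ℂ}
    {P Q : Matrix n m ℂ} (hP : IsMoorePenrose M P) (hQ : IsMoorePenrose M Q) : P = Q := by
  have e1 : M * P = M * Q := by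
    calc M * P = (M * Q * M) * P := by rw [hQ.mul_mul_self]
      _ = (M * Q)ᴴ * (M * P)ᴴ := by
          rw [hQ.isHermitian_left, hP.isHermitian_left, Matrix.mul_assoc (M * Q)]
      _ = (M * P * M * Q)ᴴ := by rw [← conjTranspose_mul]; simp only [Matrix.mul_assoc]
      _ = M * Q := by rw [hP.mul_mul_self, hQ.isHermitian_left]
  have e2 : P * M = Q * M := by
    calc P * M = P * (M * Q * M) := by rw [hQ.mul_mul_self]
      _ = (P * M)ᴴ * (Q * M)ᴴ := by
          rw [hP.isHermitian_right, hQ.isHermitian_right]; simp only [Matrix.mul_assoc]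
      _ = (Q * (M * P * M))ᴴ := by rw [← conjTranspose_mul]; simp only [Matrix.mul_assoc]
      _ = Q * M := by rw [hP.mul_mul_self, hQ.isHermitian_right]
  calc P = P * M * P := hP.mul_mul_inv.symm
    _ = Q * (M * P) := by rw [e2, Matrix.mul_assoc]
    _ = Q * M * Q := by rw [e1, Matrix.mul_assoc]
    _ = Q := hQ.mul_mul_inv

/-- The Moore-Penrose inverse `M⁺`. -/
noncomputable def pinv {m n : Type*} [Fintype m] [Fintype n] (M : Matrix m n ℂ) :
    Matrix n m ℂ :=
  Classical.choose (exists_isMoorePenrose M)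

/-- `pinv M` satisfies the Penrose equations. -/
theorem pinv_spec {m n : Type*} [Fintype m] [Fintype n] (M : Matrix m n ℂ) :
    IsMoorePenrose M (pinv M) :=
  Classical.choose_spec (exists_isMoorePenrose M)

/-- The generalized determinant: the determinant of the linear map
`R(H) → R(H)` obtained by restricting `H` to its range `R(H)`. For `H = 0` the range is the
zero space, on which every endomorphism has determinant `1`. -/
noncomputable def detPlus {n : Type*} [Fintype n] (H : Matrix n n ℂ) : ℂ :=
  LinearMap.det
    (H.mulVecLin.restrict (p := LinearMap.range H.mulVecLin) (q := LinearMap.range H.mulVecLin)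
      (fun x _ => LinearMap.mem_range_self H.mulVecLin x))

/-- The convention for the zero matrix. -/
theorem detPlus_zero {n : Type*} [Fintype n] : detPlus (0 : Matrix n n ℂ) = 1 := by
  have : Subsingleton (LinearMap.range (0 : Matrix n n ℂ).mulVecLin) := by
    rw [Matrix.mulVecLin_zero, LinearMap.range_zero]
    infer_instance
  exact LinearMap.det_eq_one_of_subsingleton _

/-- The matrix `[[A, B], [B*, C]]` is of maximal rank with respect to its partition:
its null space is `N(A) ⊕ N(C)`. (Used for positive semidefinite matrices.) -/
def IsMaximalRank₂ {m n : Type*} [Fintype m] [Fintype n]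
    (H : Matrix (m ⊕ n) (m ⊕ n) ℂ) : Prop :=
  ∀ (u : m → ℂ) (v : n → ℂ),
    H *ᵥ Sum.elim u v = 0 ↔ H.toBlocks₁₁ *ᵥ u = 0 ∧ H.toBlocks₂₂ *ᵥ v = 0

/-- A matrix partitioned into three by three blocks with diagonal blocks `A`, `C`, `E` is of
maximal rank with respect to its partition: its null space is `N(A) ⊕ N(C) ⊕ N(E)`.
(Used for positive semidefinite matrices.) -/
def IsMaximalRank₃ {m n k : Type*} [Fintype m] [Fintype n] [Fintype k]
    (H : Matrix ((m ⊕ n) ⊕ k) ((m ⊕ n) ⊕ k) ℂ) : Prop :=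
  ∀ (u : m → ℂ) (v : n → ℂ) (w : k → ℂ),
    H *ᵥ Sum.elim (Sum.elim u v) w = 0 ↔
      H.toBlocks₁₁.toBlocks₁₁ *ᵥ u = 0 ∧ H.toBlocks₁₁.toBlocks₂₂ *ᵥ v = 0 ∧
        H.toBlocks₂₂ *ᵥ w = 0

/-- The block matrix `[[A, B], [B*, C]]`. -/
def block₂ {m n : Type*} (A : Matrix m m ℂ) (B : Matrix m n ℂ) (C : Matrix n n ℂ) :
    Matrix (m ⊕ n) (m ⊕ n) ℂ :=
  fromBlocks A B Bᴴ C

/-- The block matrix `[[A, B, X], [B*, C, D], [X*, D*, E]]`. -/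
def block₃ {m n k : Type*} (A : Matrix m m ℂ) (B : Matrix m n ℂ) (X : Matrix m k ℂ)
    (C : Matrix n n ℂ) (D : Matrix n k ℂ) (E : Matrix k k ℂ) :
    Matrix ((m ⊕ n) ⊕ k) ((m ⊕ n) ⊕ k) ℂ :=
  fromBlocks (fromBlocks A B Bᴴ C) (fromRows X D) (fromCols Xᴴ Dᴴ) E

end PSDCompletion

namespace PSDCompletion

open scoped MatrixOrder

/-! The problem reduces to the positive definite one. If `G` is positive semidefinite and `P` is the
orthogonal projection onto its null space, then `G + P` is positive definite and has determinant
`detPlus G`. Maximal rank makes `P` block diagonal and independent of the off-diagonal blocks, so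
adding it only replaces `A`, `C`, `E` by invertible matrices and leaves `B`, `D`, `X` alone
(`block₃_add_blockNullProj₃`).

In the definite case write `X = B C⁻¹ D + Z` and let `G` be the leading two by two blocks. The Schur
complement of `G` is `E - D* C⁻¹ D` minus `V* G⁻¹ V`, where `V` is `Z` stacked on zero
(`schur_complement_block₃`). The subtracted term is positive semidefinite and nonzero unless `Z =
0`, so it strictly lowers the determinant (`det_lt_det_add`).

Since `B` kills the null space of `C`, the definite maximizer is `B C⁺ D`
(`mul_inv_add_nullProj_mul`). -/

/-! ### Strict monotonicity of the determinant -/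

theorem one_add_sum_le_prod_one_add {ι : Type*} (s : Finset ι) (f : ι → ℝ)
    (hf : ∀ i ∈ s, 0 ≤ f i) : 1 + ∑ i ∈ s, f i ≤ ∏ i ∈ s, (1 + f i) := by
  classical
  induction s using Finset.induction_on with
  | empty => simp
  | insert a s ha ih =>
    rw [Finset.sum_insert ha, Finset.prod_insert ha]
    have h1 := ih fun i hi => hf i (Finset.mem_insert_of_mem hi)
    have h2 := hf a (Finset.mem_insert_self a s)
    have h3 : 0 ≤ ∑ i ∈ s, f i :=
      Finset.sum_nonneg fun i hi => hf i (Finset.mem_insert_of_mem hi)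
    nlinarith [mul_nonneg h2 h3]

theorem det_one_add_eq_prod {n : Type*} [Fintype n] [DecidableEq n] {M : Matrix n n ℂ}
    (hM : M.IsHermitian) : (1 + M).det = ∏ i, (1 + (hM.eigenvalues i : ℂ)) := by
  -- At `-1` the characteristic polynomial is `det (-(1 + M))`; the sign cancels against that of the
  -- product.
  have h := congrArg (Polynomial.eval (-1)) hM.charpoly_eq
  rw [Matrix.eval_charpoly, Polynomial.eval_prod] at h
  have e : scalar n (-1 : ℂ) - M = -(1 + M) := by
    rw [map_neg, map_one]; abel
  rw [e, Matrix.det_neg] at h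
  have h2 : ∏ i, Polynomial.eval (-1 : ℂ) (Polynomial.X - Polynomial.C (hM.eigenvalues i : ℂ)) =
      (-1) ^ Fintype.card n * ∏ i, (1 + (hM.eigenvalues i : ℂ)) := by
    rw [← Finset.card_univ, ← Finset.prod_const, ← Finset.prod_mul_distrib]
    refine Finset.prod_congr rfl fun i _ => ?_
    simp only [Polynomial.eval_sub, Polynomial.eval_X, Polynomial.eval_C]
    ring
  exact mul_left_cancel₀ (pow_ne_zero _ (by norm_num)) (h.trans h2)

/-- The product of the `1 + λᵢ` is at least one plus the trace, and a nonzero positive semidefinite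
matrix has positive trace. -/
theorem one_lt_det_one_add {n : Type*} [Fintype n] [DecidableEq n] {M : Matrix n n ℂ}
    (hM : M.PosSemidef) (h0 : M ≠ 0) : 1 < (1 + M).det := by
  rw [det_one_add_eq_prod hM.1]
  have h1 := one_add_sum_le_prod_one_add Finset.univ hM.1.eigenvalues
    fun i _ => hM.eigenvalues_nonneg i
  have h2 : 0 ≤ ∑ i, hM.1.eigenvalues i := Finset.sum_nonneg fun i _ => hM.eigenvalues_nonneg i
  have h3 : ∑ i, hM.1.eigenvalues i ≠ 0 := by
    intro h
    apply h0
    rw [← hM.trace_eq_zero_iff, hM.1.trace_eq_sum_eigenvalues]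
    exact (Complex.ofReal_sum Finset.univ hM.1.eigenvalues).symm.trans
      (by rw [h, Complex.ofReal_zero])
  have h4 : 1 < ∏ i, (1 + hM.1.eigenvalues i) := by
    have := lt_of_le_of_ne h2 h3.symm
    linarith
  exact_mod_cast h4

/-- The determinant is strictly increasing along positive semidefinite perturbations of a
positive definite matrix. -/
theorem det_lt_det_add {n : Type*} [Fintype n] [DecidableEq n] {T S : Matrix n n ℂ}
    (hT : T.PosDef) (hS : S.PosSemidef) (h0 : S ≠ 0) : T.det < (T + S).det := by
  obtain ⟨L, hL⟩ := CStarAlgebra.nonneg_iff_eq_star_mul_self.mp hT.posSemidef.nonneg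
  rw [star_eq_conjTranspose] at hL
  have hdet : IsUnit L.det := by
    have h := hT.det_pos.ne'
    rw [hL, Matrix.det_mul] at h
    exact isUnit_iff_ne_zero.mpr (right_ne_zero_of_mul h)
  have e1 : L⁻¹ * L = 1 := Matrix.nonsing_inv_mul L hdet
  have e2 : Lᴴ * L⁻¹ᴴ = 1 := by rw [← conjTranspose_mul, e1, conjTranspose_one]
  -- Congruence by `L`, where `T = Lᴴ * L`, reduces to the case `T = 1`.
  have key : T + S = Lᴴ * (1 + L⁻¹ᴴ * S * L⁻¹) * L := by
    rw [Matrix.mul_add, Matrix.add_mul, Matrix.mul_one, ← hL]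
    congr 1
    calc S = (Lᴴ * L⁻¹ᴴ) * S * (L⁻¹ * L) := by rw [e1, e2]; simp
      _ = _ := by simp only [Matrix.mul_assoc]
  have hM : L⁻¹ᴴ * S * L⁻¹ ≠ 0 := by
    intro h
    rw [h, add_zero, Matrix.mul_one, ← hL] at key
    exact h0 (by simpa using key)
  have h1 := one_lt_det_one_add (hS.conjTranspose_mul_mul_same L⁻¹) hM
  have h2 : (T + S).det = T.det * (1 + L⁻¹ᴴ * S * L⁻¹).det := by
    rw [key, Matrix.det_mul, Matrix.det_mul]
    conv_rhs => rw [hL, Matrix.det_mul]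
    ring
  rw [h2]
  exact lt_mul_of_one_lt_right hT.det_pos h1

/-! ### Schur complements and the positive definite case -/

/-- The semidefinite Schur criterion upgrades to definiteness because the determinant factors, so
both sides are singular together. -/
theorem posDef_fromBlocks₁₁_iff {m n : Type*} [Fintype m] [Fintype n] [DecidableEq m]
    {A : Matrix m m ℂ} (hA : A.PosDef) (B : Matrix m n ℂ) (D : Matrix n n ℂ) :
    (fromBlocks A B Bᴴ D).PosDef ↔ (D - Bᴴ * A⁻¹ * B).PosDef := by
  classical
  let _ : Invertible A := hA.isUnit.invertible
  have hdet : (fromBlocks A B Bᴴ D).det = A.det * (D - Bᴴ * A⁻¹ * B).det := by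
    rw [det_fromBlocks₁₁, Matrix.invOf_eq_nonsing_inv]
  have hs := Matrix.PosDef.fromBlocks₁₁ B D hA
  constructor
  · intro h
    rw [(hs.mp h.posSemidef).posDef_iff_det_ne_zero]
    have := h.det_pos.ne'
    rw [hdet] at this
    exact right_ne_zero_of_mul this
  · intro h
    rw [(hs.mpr h.posSemidef).posDef_iff_det_ne_zero, hdet]
    exact mul_ne_zero hA.det_pos.ne' h.det_pos.ne'

theorem det_fromBlocks_of_posDef₁₁ {m n : Type*} [Fintype m] [Fintype n] [DecidableEq m]
    [DecidableEq n] {A : Matrix m m ℂ} (hA : A.PosDef) (B : Matrix m n ℂ) (D : Matrix n n ℂ) :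
    (fromBlocks A B Bᴴ D).det = A.det * (D - Bᴴ * A⁻¹ * B).det := by
  let _ : Invertible A := hA.isUnit.invertible
  rw [det_fromBlocks₁₁, Matrix.invOf_eq_nonsing_inv]

theorem block₃_eq_fromBlocks {m n k : Type*} (A : Matrix m m ℂ) (B : Matrix m n ℂ)
    (X : Matrix m k ℂ) (C : Matrix n n ℂ) (D : Matrix n k ℂ) (E : Matrix k k ℂ) :
    block₃ A B X C D E = fromBlocks (block₂ A B C) (fromRows X D) (fromRows X D)ᴴ E := by
  rw [conjTranspose_fromRows_eq_fromCols_conjTranspose]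
  rfl

section PositiveDefinite

theorem posDef_of_block₂ {n k : Type*} {C : Matrix n n ℂ} {D : Matrix n k ℂ} {E : Matrix k k ℂ}
    (hβ : (block₂ C D E).PosDef) : C.PosDef := by
  have h : C = (block₂ C D E).submatrix Sum.inl Sum.inl := by ext; rfl
  rw [h]
  exact hβ.submatrix Sum.inl_injective

variable {m n k : Type*} [Fintype m] [Fintype n] [DecidableEq m] [DecidableEq n]
  {A : Matrix m m ℂ} {B : Matrix m n ℂ} {C : Matrix n n ℂ} {D : Matrix n k ℂ} {E : Matrix k k ℂ}

/-- The Schur complement of the leading two by two blocks, in terms of the deviation `Z` of the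
corner block from `B C⁻¹ D`. -/
theorem schur_complement_block₃ (hC : C.PosDef) (hα : (block₂ A B C).PosDef)
    (Z : Matrix m k ℂ) :
    E - (fromRows (B * C⁻¹ * D + Z) D)ᴴ * (block₂ A B C)⁻¹ * fromRows (B * C⁻¹ * D + Z) D =
      (E - Dᴴ * C⁻¹ * D) -
        (fromRows Z (0 : Matrix n k ℂ))ᴴ * (block₂ A B C)⁻¹ * fromRows Z (0 : Matrix n k ℂ) := by
  set G := block₂ A B C with hG
  have hGu : IsUnit G.det := (Matrix.isUnit_iff_isUnit_det G).mp hα.isUnit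
  have hCu : IsUnit C.det := (Matrix.isUnit_iff_isUnit_det C).mp hC.isUnit
  -- `W` solves `G * W = fromRows (B * C⁻¹ * D) D`. It lives in the second block and `V` in the
  -- first, so the cross terms vanish.
  set W : Matrix (m ⊕ n) k ℂ := fromRows (0 : Matrix m k ℂ) (C⁻¹ * D) with hW
  set V : Matrix (m ⊕ n) k ℂ := fromRows Z (0 : Matrix n k ℂ) with hV
  have hGW : G * W = fromRows (B * C⁻¹ * D) D := by
    rw [hG, hW, block₂, fromBlocks_mul_fromRows]
    rw [Matrix.mul_zero, Matrix.mul_zero, zero_add, zero_add, ← Matrix.mul_assoc,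
      ← Matrix.mul_assoc, Matrix.mul_nonsing_inv C hCu, Matrix.one_mul]
  have hsum : fromRows (B * C⁻¹ * D + Z) D = G * W + V := by
    rw [hGW, hV]
    ext (i | i) j <;> simp
  have hWV : Wᴴ * V = 0 := by
    rw [hW, hV, conjTranspose_fromRows_eq_fromCols_conjTranspose, fromCols_mul_fromRows]
    simp
  have hVW : Vᴴ * W = 0 := by
    rw [← conjTranspose_conjTranspose W, ← conjTranspose_mul, hWV, conjTranspose_zero]
  have hWGW : Wᴴ * (G * W) = Dᴴ * C⁻¹ * D := by
    rw [hGW, hW, conjTranspose_fromRows_eq_fromCols_conjTranspose, fromCols_mul_fromRows,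
      conjTranspose_mul, conjTranspose_nonsing_inv, hC.isHermitian.eq]
    simp
  have hinv : G⁻¹ * (G * W) = W := by
    rw [← Matrix.mul_assoc, Matrix.nonsing_inv_mul G hGu, Matrix.one_mul]
  have hinv' : (G * W)ᴴ * (G⁻¹ * V) = 0 := by
    rw [conjTranspose_mul, hα.isHermitian.eq, Matrix.mul_assoc, ← Matrix.mul_assoc G,
      Matrix.mul_nonsing_inv G hGu, Matrix.one_mul, hWV]
  have hGWW : (G * W)ᴴ * W = Dᴴ * C⁻¹ * D := by
    rw [conjTranspose_mul, hα.isHermitian.eq, Matrix.mul_assoc, hWGW]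
  rw [hsum, sub_sub, Matrix.mul_assoc, Matrix.mul_assoc Vᴴ, conjTranspose_add, Matrix.mul_add,
    Matrix.add_mul, Matrix.mul_add, Matrix.mul_add, hinv, hinv', hGWW, hVW, zero_add, add_zero]

/-- At `Z = 0` the Schur complement is that of `C` in `block₂ C D E`. -/
theorem posDef_block₃_inv [Fintype k] (hα : (block₂ A B C).PosDef) (hβ : (block₂ C D E).PosDef) :
    (block₃ A B (B * C⁻¹ * D) C D E).PosDef := by
  have hC := posDef_of_block₂ hβ
  rw [block₃_eq_fromBlocks, posDef_fromBlocks₁₁_iff hα]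
  have h := schur_complement_block₃ (D := D) (E := E) hC hα 0
  rw [add_zero, fromRows_zero, Matrix.mul_zero, sub_zero] at h
  rw [h, ← posDef_fromBlocks₁₁_iff hC]
  exact hβ

theorem det_block₃_lt [Fintype k] [DecidableEq k] (hα : (block₂ A B C).PosDef) (hβ : (block₂ C D E).PosDef)
    {X : Matrix m k ℂ} (hX : (block₃ A B X C D E).PosDef) (hne : X ≠ B * C⁻¹ * D) :
    (block₃ A B X C D E).det < (block₃ A B (B * C⁻¹ * D) C D E).det := by
  have hC := posDef_of_block₂ hβ
  obtain ⟨Z, rfl⟩ : ∃ Z, X = B * C⁻¹ * D + Z := ⟨X - B * C⁻¹ * D, by abel⟩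
  have hZ : Z ≠ 0 := by rintro rfl; exact hne (add_zero _)
  have h := schur_complement_block₃ (D := D) (E := E) hC hα 0
  rw [add_zero, fromRows_zero, Matrix.mul_zero, sub_zero] at h
  have h' := schur_complement_block₃ (D := D) (E := E) hC hα Z
  rw [block₃_eq_fromBlocks, posDef_fromBlocks₁₁_iff hα, h'] at hX
  rw [block₃_eq_fromBlocks, block₃_eq_fromBlocks, det_fromBlocks_of_posDef₁₁ hα,
    det_fromBlocks_of_posDef₁₁ hα, h, h']
  refine mul_lt_mul_of_pos_left ?_ hα.det_pos
  set V : Matrix (m ⊕ n) k ℂ := fromRows Z (0 : Matrix n k ℂ) with hV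
  have hS : (Vᴴ * (block₂ A B C)⁻¹ * V).PosSemidef :=
    hα.inv.posSemidef.conjTranspose_mul_mul_same V
  have hS0 : Vᴴ * (block₂ A B C)⁻¹ * V ≠ 0 := by
    intro h0
    apply hZ
    have hVz : V = 0 := by
      obtain ⟨L, hL⟩ := CStarAlgebra.nonneg_iff_eq_star_mul_self.mp hα.inv.posSemidef.nonneg
      rw [star_eq_conjTranspose] at hL
      have hd := hα.inv.det_pos.ne'
      rw [hL, Matrix.det_mul] at hd
      have hLu : IsUnit L.det := isUnit_iff_ne_zero.mpr (right_ne_zero_of_mul hd)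
      have hLV : L * V = 0 := by
        rw [← conjTranspose_mul_self_eq_zero, ← h0, hL, conjTranspose_mul]
        simp only [Matrix.mul_assoc]
      calc V = L⁻¹ * (L * V) := by
            rw [← Matrix.mul_assoc, Matrix.nonsing_inv_mul L hLu, Matrix.one_mul]
        _ = 0 := by rw [hLV, Matrix.mul_zero]
    ext i j
    exact congrFun (congrFun hVz (Sum.inl i)) j
  have := det_lt_det_add hX hS hS0
  rwa [sub_add_cancel] at this

end PositiveDefinite

/-! ### Projection onto the null space and the generalized determinant -/

section NullProjection

theorem isHermitian_pinv {n : Type*} [Fintype n] {G : Matrix n n ℂ} (hG : G.IsHermitian) :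
    (pinv G).IsHermitian := by
  obtain ⟨P, hP, hPh⟩ := exists_isMoorePenrose_of_isHermitian hG
  rwa [(pinv_spec G).eq hP]

theorem pinv_mul_comm {n : Type*} [Fintype n] {G : Matrix n n ℂ} (hG : G.IsHermitian) :
    pinv G * G = G * pinv G := by
  have h := (pinv_spec G).isHermitian_right.eq
  rw [conjTranspose_mul, hG.eq, (isHermitian_pinv hG).eq] at h
  exact h.symm

variable {n : Type*} [Fintype n] [DecidableEq n] {G : Matrix n n ℂ}

/-- The orthogonal projection onto the null space. -/
noncomputable def nullProj (G : Matrix n n ℂ) : Matrix n n ℂ := 1 - pinv G * G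

theorem isHermitian_nullProj (G : Matrix n n ℂ) : (nullProj G).IsHermitian :=
  isHermitian_one.sub (pinv_spec G).isHermitian_right

theorem mul_nullProj (G : Matrix n n ℂ) : G * nullProj G = 0 := by
  rw [nullProj, Matrix.mul_sub, ← Matrix.mul_assoc, (pinv_spec G).mul_mul_self, Matrix.mul_one,
    sub_self]

theorem nullProj_mul (hG : G.IsHermitian) : nullProj G * G = 0 := by
  have h := congrArg conjTranspose (mul_nullProj G)
  rwa [conjTranspose_mul, hG.eq, (isHermitian_nullProj G).eq, conjTranspose_zero] at h

theorem nullProj_mul_self (G : Matrix n n ℂ) : nullProj G * nullProj G = nullProj G := by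
  conv_lhs => enter [1]; rw [nullProj]
  rw [Matrix.sub_mul, Matrix.mul_assoc, mul_nullProj, Matrix.mul_zero, sub_zero, Matrix.one_mul]

theorem nullProj_mulVec_eq_iff (G : Matrix n n ℂ) (x : n → ℂ) :
    nullProj G *ᵥ x = x ↔ G *ᵥ x = 0 := by
  constructor
  · intro h
    rw [← h, mulVec_mulVec, mul_nullProj, zero_mulVec]
  · intro h
    rw [nullProj, sub_mulVec, one_mulVec, ← mulVec_mulVec, h, mulVec_zero, sub_zero]

/-- An orthogonal projection is determined by its fixed space: each of the two fixes the range of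
the other, and taking adjoints identifies them. -/
theorem eq_nullProj {Q : Matrix n n ℂ} (hQ : Q.IsHermitian) (hQ2 : Q * Q = Q)
    (h : ∀ x, G *ᵥ x = 0 ↔ Q *ᵥ x = x) : nullProj G = Q := by
  have key : ∀ P R : Matrix n n ℂ, (∀ x, R *ᵥ (P *ᵥ x) = P *ᵥ x) → R * P = P := by
    intro P R hPR
    apply Matrix.mulVec_injective
    ext1 x
    rw [← mulVec_mulVec, hPR]
  have h1 : Q * nullProj G = nullProj G := key _ _ fun x => by
    rw [← h, mulVec_mulVec, mul_nullProj, zero_mulVec]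
  have h2 : nullProj G * Q = Q := key _ _ fun x => by
    rw [nullProj_mulVec_eq_iff, h, mulVec_mulVec, hQ2]
  calc nullProj G = (Q * nullProj G)ᴴ := by rw [h1, (isHermitian_nullProj G).eq]
    _ = Q := by rw [conjTranspose_mul, hQ.eq, (isHermitian_nullProj G).eq, h2]

/-- The generalized determinant is the determinant after adding the null projection. -/
theorem detPlus_eq_det_add_nullProj (hG : G.IsHermitian) : detPlus G = (G + nullProj G).det := by
  set W := LinearMap.range G.mulVecLin with hW
  have hW' : ∀ x ∈ W, (G + nullProj G) *ᵥ x = G *ᵥ x := by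
    rintro _ ⟨y, rfl⟩
    rw [add_mulVec, mulVecLin_apply, mulVec_mulVec y (nullProj G), nullProj_mul hG, zero_mulVec,
      add_zero]
  have he : W ≤ W.comap (G + nullProj G).mulVecLin := by
    intro x hx
    rw [Submodule.mem_comap, mulVecLin_apply, hW' x hx]
    exact LinearMap.mem_range_self G.mulVecLin x
  -- The determinant splits along the invariant subspace `W`: the sum acts as `G` on `W` and as the
  -- identity on the quotient.
  rw [← LinearMap.det_toLin', Matrix.toLin'_apply', LinearMap.det_eq_det_mul_det W _ he]
  have h1 : W.mapQ W (G + nullProj G).mulVecLin he = LinearMap.id := by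
    refine Submodule.linearMap_qext _ (LinearMap.ext fun x => ?_)
    rw [LinearMap.comp_apply, LinearMap.comp_apply, Submodule.mkQ_apply, Submodule.mapQ_apply,
      LinearMap.id_apply, Submodule.Quotient.eq]
    -- As `nullProj G = 1 - G G⁺`, one has `(G + nullProj G) x - x = G (x - G⁺ x)`.
    refine ⟨x - pinv G *ᵥ x, ?_⟩
    rw [mulVecLin_apply, mulVecLin_apply, nullProj, pinv_mul_comm hG, add_mulVec, sub_mulVec,
      mulVec_sub, mulVec_mulVec, one_mulVec]
    abel
  rw [h1, LinearMap.det_id, mul_one, detPlus]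
  congr 1
  ext x i
  exact congrFun (hW' x x.2).symm i

theorem posDef_add_nullProj (hG : G.PosSemidef) : (G + nullProj G).PosDef := by
  have hQ : (nullProj G).PosSemidef := by
    have h := posSemidef_conjTranspose_mul_self (nullProj G)
    rwa [(isHermitian_nullProj G).eq, nullProj_mul_self] at h
  rw [(hG.add hQ).posDef_iff_isUnit, ← mulVec_injective_iff_isUnit]
  refine (injective_iff_map_eq_zero (G + nullProj G).mulVecLin).mpr fun x hx => ?_
  rw [mulVecLin_apply] at hx
  have h1 : nullProj G *ᵥ x = 0 := by
    have h := congrArg (nullProj G *ᵥ ·) hx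
    simpa [mulVec_mulVec, Matrix.mul_add, nullProj_mul hG.1, nullProj_mul_self] using h
  rw [add_mulVec, h1, add_zero] at hx
  rw [← (nullProj_mulVec_eq_iff G x).mpr hx, h1]

/-- The way back from the definite problem: `G` is the compression of `G + Q` by `1 - Q`. -/
theorem posSemidef_of_posDef_add {Q : Matrix n n ℂ} (hQ : Q.IsHermitian) (hQ2 : Q * Q = Q)
    (hGQ : G * Q = 0) (h : (G + Q).PosDef) : G.PosSemidef := by
  have hG : G.IsHermitian := by simpa using h.isHermitian.sub hQ
  have hQG : Q * G = 0 := by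
    have := congrArg conjTranspose hGQ
    rwa [conjTranspose_mul, hG.eq, hQ.eq, conjTranspose_zero] at this
  have e : G = (1 - Q)ᴴ * (G + Q) * (1 - Q) := by
    rw [conjTranspose_sub, conjTranspose_one, hQ.eq]
    simp only [Matrix.sub_mul, Matrix.mul_sub, Matrix.mul_add, Matrix.one_mul, Matrix.mul_one,
      Matrix.add_mul, hQ2, hGQ, hQG, Matrix.zero_mul]
    abel
  rw [e]
  exact h.posSemidef.conjTranspose_mul_mul_same _

theorem mulVec_eq_zero_iff_of_posDef_add {Q : Matrix n n ℂ} (hQ2 : Q * Q = Q)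
    (hGQ : G * Q = 0) (h : (G + Q).PosDef) (x : n → ℂ) : G *ᵥ x = 0 ↔ Q *ᵥ x = x := by
  constructor
  · intro hx
    -- If `G x = 0`, then `G + Q` sends both `x` and `Q x` to `Q x`.
    apply mulVec_injective_iff_isUnit.mpr h.isUnit
    rw [mulVec_mulVec, Matrix.add_mul, hQ2, hGQ, add_mulVec, add_mulVec, hx, zero_mulVec]
  · intro hx
    rw [← hx, mulVec_mulVec, hGQ, zero_mulVec]

end NullProjection

/-! ### Maximal rank as block diagonality of the null projection -/

section Blocks

variable {m n k : Type*} [Fintype m] [Fintype n] [Fintype k] [DecidableEq m] [DecidableEq n]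
  [DecidableEq k]

/-- The orthogonal projection onto `N(A) ⊕ N(C)`. -/
noncomputable def blockNullProj₂ (A : Matrix m m ℂ) (C : Matrix n n ℂ) :
    Matrix (m ⊕ n) (m ⊕ n) ℂ :=
  fromBlocks (nullProj A) 0 0 (nullProj C)

/-- The orthogonal projection onto `N(A) ⊕ N(C) ⊕ N(E)`. -/
noncomputable def blockNullProj₃ (A : Matrix m m ℂ) (C : Matrix n n ℂ) (E : Matrix k k ℂ) :
    Matrix ((m ⊕ n) ⊕ k) ((m ⊕ n) ⊕ k) ℂ :=
  fromBlocks (blockNullProj₂ A C) 0 0 (nullProj E)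

theorem isHermitian_blockNullProj₂ (A : Matrix m m ℂ) (C : Matrix n n ℂ) :
    (blockNullProj₂ A C).IsHermitian :=
  (isHermitian_nullProj A).fromBlocks conjTranspose_zero (isHermitian_nullProj C)

theorem isHermitian_blockNullProj₃ (A : Matrix m m ℂ) (C : Matrix n n ℂ) (E : Matrix k k ℂ) :
    (blockNullProj₃ A C E).IsHermitian :=
  (isHermitian_blockNullProj₂ A C).fromBlocks conjTranspose_zero (isHermitian_nullProj E)

theorem blockNullProj₂_mul_self (A : Matrix m m ℂ) (C : Matrix n n ℂ) :
    blockNullProj₂ A C * blockNullProj₂ A C = blockNullProj₂ A C := by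
  simp [blockNullProj₂, fromBlocks_multiply, nullProj_mul_self]

theorem blockNullProj₃_mul_self (A : Matrix m m ℂ) (C : Matrix n n ℂ) (E : Matrix k k ℂ) :
    blockNullProj₃ A C E * blockNullProj₃ A C E = blockNullProj₃ A C E := by
  simp [blockNullProj₃, fromBlocks_multiply, nullProj_mul_self, blockNullProj₂_mul_self]

theorem blockNullProj₂_mulVec_eq_iff (A : Matrix m m ℂ) (C : Matrix n n ℂ) (u : m → ℂ)
    (v : n → ℂ) : blockNullProj₂ A C *ᵥ Sum.elim u v = Sum.elim u v ↔
      A *ᵥ u = 0 ∧ C *ᵥ v = 0 := by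
  rw [blockNullProj₂, fromBlocks_mulVec, Sum.elim_eq_iff]
  simp [nullProj_mulVec_eq_iff]

theorem blockNullProj₃_mulVec_eq_iff (A : Matrix m m ℂ) (C : Matrix n n ℂ) (E : Matrix k k ℂ)
    (u : m → ℂ) (v : n → ℂ) (w : k → ℂ) :
    blockNullProj₃ A C E *ᵥ Sum.elim (Sum.elim u v) w = Sum.elim (Sum.elim u v) w ↔
      A *ᵥ u = 0 ∧ C *ᵥ v = 0 ∧ E *ᵥ w = 0 := by
  rw [blockNullProj₃, fromBlocks_mulVec, Sum.elim_eq_iff]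
  simp [nullProj_mulVec_eq_iff, blockNullProj₂_mulVec_eq_iff, and_assoc]

theorem nullProj_block₂ {A : Matrix m m ℂ} {B : Matrix m n ℂ} {C : Matrix n n ℂ}
    (h : IsMaximalRank₂ (block₂ A B C)) : nullProj (block₂ A B C) = blockNullProj₂ A C := by
  refine eq_nullProj (isHermitian_blockNullProj₂ A C) (blockNullProj₂_mul_self A C) fun x => ?_
  rw [← Sum.elim_comp_inl_inr x, blockNullProj₂_mulVec_eq_iff]
  exact h _ _

theorem nullProj_block₃ {A : Matrix m m ℂ} {B : Matrix m n ℂ} {X : Matrix m k ℂ}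
    {C : Matrix n n ℂ} {D : Matrix n k ℂ} {E : Matrix k k ℂ}
    (h : IsMaximalRank₃ (block₃ A B X C D E)) :
    nullProj (block₃ A B X C D E) = blockNullProj₃ A C E := by
  refine eq_nullProj (isHermitian_blockNullProj₃ A C E) (blockNullProj₃_mul_self A C E) fun x => ?_
  rw [← Sum.elim_comp_inl_inr x, ← Sum.elim_comp_inl_inr (x ∘ Sum.inl),
    blockNullProj₃_mulVec_eq_iff]
  exact h _ _ _

theorem block₂_add_blockNullProj₂ (A : Matrix m m ℂ) (B : Matrix m n ℂ) (C : Matrix n n ℂ) :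
    block₂ A B C + blockNullProj₂ A C = block₂ (A + nullProj A) B (C + nullProj C) := by
  simp [block₂, blockNullProj₂, fromBlocks_add]

theorem block₃_add_blockNullProj₃ (A : Matrix m m ℂ) (B : Matrix m n ℂ) (X : Matrix m k ℂ)
    (C : Matrix n n ℂ) (D : Matrix n k ℂ) (E : Matrix k k ℂ) :
    block₃ A B X C D E + blockNullProj₃ A C E =
      block₃ (A + nullProj A) B X (C + nullProj C) D (E + nullProj E) := by
  simp [block₃, blockNullProj₂, blockNullProj₃, fromBlocks_add]

theorem posDef_block₂_add {A : Matrix m m ℂ} {B : Matrix m n ℂ} {C : Matrix n n ℂ}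
    (h : (block₂ A B C).PosSemidef) (hr : IsMaximalRank₂ (block₂ A B C)) :
    (block₂ (A + nullProj A) B (C + nullProj C)).PosDef := by
  rw [← block₂_add_blockNullProj₂, ← nullProj_block₂ hr]
  exact posDef_add_nullProj h

/-- These are the off-diagonal blocks of `H * nullProj H = 0`, the projection being block diagonal.
-/
theorem mul_nullProj_of_isMaximalRank₂ {A : Matrix m m ℂ} {B : Matrix m n ℂ} {C : Matrix n n ℂ}
    (hr : IsMaximalRank₂ (block₂ A B C)) : Bᴴ * nullProj A = 0 ∧ B * nullProj C = 0 := by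
  have h := mul_nullProj (block₂ A B C)
  rw [nullProj_block₂ hr, block₂, blockNullProj₂, fromBlocks_multiply, ← fromBlocks_zero,
    fromBlocks_inj] at h
  simpa using And.intro h.2.2.1 h.2.1

/-- `C` is inverted by `C⁺` on its range, and the projection is its own inverse on the orthogonal
complement. -/
theorem inv_add_nullProj {C : Matrix n n ℂ} (hC : C.IsHermitian) :
    (C + nullProj C)⁻¹ = pinv C + nullProj C := by
  refine Matrix.inv_eq_right_inv ?_
  have h : nullProj C * pinv C = 0 := by
    rw [nullProj, Matrix.sub_mul, (pinv_spec C).mul_mul_inv, Matrix.one_mul, sub_self]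
  rw [Matrix.add_mul, Matrix.mul_add, Matrix.mul_add, mul_nullProj, nullProj_mul_self, h,
    ← pinv_mul_comm hC, nullProj]
  abel

end Blocks

/-! ### Transfer to semidefinite completions of maximal rank -/

section Completion

theorem mul_inv_add_nullProj_mul {m n k : Type*} [Fintype m] [Fintype n] [DecidableEq n]
    {A : Matrix m m ℂ} {B : Matrix m n ℂ} {C : Matrix n n ℂ} (D : Matrix n k ℂ)
    (hαr : IsMaximalRank₂ (block₂ A B C)) (hC : C.IsHermitian) :
    B * (C + nullProj C)⁻¹ * D = B * pinv C * D := by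
  classical
  rw [inv_add_nullProj hC, Matrix.mul_add, (mul_nullProj_of_isMaximalRank₂ hαr).2, add_zero]

variable {m n k : Type*} [Fintype m] [Fintype n] [Fintype k]
  {A : Matrix m m ℂ} {B : Matrix m n ℂ} {C : Matrix n n ℂ} {D : Matrix n k ℂ} {E : Matrix k k ℂ}

/-- The corner `B C⁺ D` inherits from `B` and `D` the vanishing on the null spaces of `A` and `E`.
This is the hypothesis needed to return from the definite problem. -/
theorem block₃_mul_blockNullProj₃ [DecidableEq m] [DecidableEq n] [DecidableEq k]
    (hαr : IsMaximalRank₂ (block₂ A B C)) (hβr : IsMaximalRank₂ (block₂ C D E)) :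
    block₃ A B (B * pinv C * D) C D E * blockNullProj₃ A C E = 0 := by
  obtain ⟨hBA, hBC⟩ := mul_nullProj_of_isMaximalRank₂ hαr
  obtain ⟨hDC, hDE⟩ := mul_nullProj_of_isMaximalRank₂ hβr
  have hXA : (B * pinv C * D)ᴴ * nullProj A = 0 := by
    rw [Matrix.mul_assoc B, conjTranspose_mul, Matrix.mul_assoc, hBA, Matrix.mul_zero]
  have hXE : B * pinv C * D * nullProj E = 0 := by
    rw [Matrix.mul_assoc, hDE, Matrix.mul_zero]
  have h₂₁ : fromCols (B * pinv C * D)ᴴ Dᴴ * blockNullProj₂ A C = 0 := by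
    rw [blockNullProj₂, fromCols_mul_fromBlocks, hXA, hDC, Matrix.mul_zero, Matrix.mul_zero,
      add_zero, add_zero, fromCols_zero]
  have h₁₂ : fromRows (B * pinv C * D) D * nullProj E = 0 := by
    rw [fromRows_mul, hXE, hDE, fromRows_zero]
  have h₁₁ : fromBlocks A B Bᴴ C * blockNullProj₂ A C = 0 := by
    rw [blockNullProj₂, fromBlocks_multiply, hBA, hBC, mul_nullProj, mul_nullProj]
    simp
  rw [block₃, blockNullProj₃, fromBlocks_multiply, h₁₁, h₁₂, h₂₁, mul_nullProj]
  simp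

/-- `B C⁺ D` completes the matrix to a positive semidefinite matrix of maximal rank. -/
theorem posSemidef_and_isMaximalRank₃_block₃_pinv
    (hα : (block₂ A B C).PosSemidef) (hαr : IsMaximalRank₂ (block₂ A B C))
    (hβ : (block₂ C D E).PosSemidef) (hβr : IsMaximalRank₂ (block₂ C D E)) :
    (block₃ A B (B * pinv C * D) C D E).PosSemidef ∧
      IsMaximalRank₃ (block₃ A B (B * pinv C * D) C D E) := by
  classical
  have hmul := block₃_mul_blockNullProj₃ hαr hβr
  have h₀ : (block₃ A B (B * pinv C * D) C D E + blockNullProj₃ A C E).PosDef := by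
    rw [block₃_add_blockNullProj₃,
      ← mul_inv_add_nullProj_mul D hαr (isHermitian_fromBlocks_iff.mp hβ.isHermitian |>.1)]
    exact posDef_block₃_inv (posDef_block₂_add hα hαr) (posDef_block₂_add hβ hβr)
  exact ⟨posSemidef_of_posDef_add (isHermitian_blockNullProj₃ A C E)
      (blockNullProj₃_mul_self A C E) hmul h₀,
    fun u v w => (mulVec_eq_zero_iff_of_posDef_add (blockNullProj₃_mul_self A C E) hmul h₀ _).trans
      (blockNullProj₃_mulVec_eq_iff A C E u v w)⟩

/-- Every completion other than `B C⁺ D` has a strictly smaller generalized determinant. -/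
theorem detPlus_block₃_lt
    (hα : (block₂ A B C).PosSemidef) (hαr : IsMaximalRank₂ (block₂ A B C))
    (hβ : (block₂ C D E).PosSemidef) (hβr : IsMaximalRank₂ (block₂ C D E)) {Y : Matrix m k ℂ}
    (hY : (block₃ A B Y C D E).PosSemidef) (hYr : IsMaximalRank₃ (block₃ A B Y C D E))
    (hne : Y ≠ B * pinv C * D) :
    detPlus (block₃ A B Y C D E) < detPlus (block₃ A B (B * pinv C * D) C D E) := by
  classical
  obtain ⟨hX, hXr⟩ := posSemidef_and_isMaximalRank₃_block₃_pinv hα hαr hβ hβr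
  have hpd := posDef_add_nullProj hY
  rw [nullProj_block₃ hYr, block₃_add_blockNullProj₃] at hpd
  rw [detPlus_eq_det_add_nullProj hY.isHermitian, detPlus_eq_det_add_nullProj hX.isHermitian,
    nullProj_block₃ hYr, nullProj_block₃ hXr, block₃_add_blockNullProj₃,
    block₃_add_blockNullProj₃]
  -- Both completions now have the same definite diagonal blocks, and the corner takes its `B C⁻¹ D`
  -- form.
  rw [← mul_inv_add_nullProj_mul D hαr (isHermitian_fromBlocks_iff.mp hβ.isHermitian |>.1)] at hne ⊢
  exact det_block₃_lt (posDef_block₂_add hα hαr) (posDef_block₂_add hβ hβr) hpd hne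

end Completion

end PSDCompletion

/-- Let `H[α] = [[A, B], [B*, C]]` and `H[β] = [[C, D], [D*, E]]` be positive semidefinite and of
maximal rank. Then `X = B C⁺ D` is the one and only `X` such that
`H = [[A, B, X], [B*, C, D], [X*, D*, E]]` is positive semidefinite, of maximal rank, and has the
largest generalized determinant among all positive semidefinite completions of maximal rank. -/
theorem mainTheorem1 {m n k : Type*} [Fintype m] [Fintype n] [Fintype k]
    (A : Matrix m m ℂ) (B : Matrix m n ℂ) (C : Matrix n n ℂ) (D : Matrix n k ℂ)
    (E : Matrix k k ℂ)
    (hα : (PSDCompletion.block₂ A B C).PosSemidef)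
    (hαr : PSDCompletion.IsMaximalRank₂ (PSDCompletion.block₂ A B C))
    (hβ : (PSDCompletion.block₂ C D E).PosSemidef)
    (hβr : PSDCompletion.IsMaximalRank₂ (PSDCompletion.block₂ C D E))
    (X : Matrix m k ℂ) :
    ((PSDCompletion.block₃ A B X C D E).PosSemidef ∧
      PSDCompletion.IsMaximalRank₃ (PSDCompletion.block₃ A B X C D E) ∧
      ∀ Y : Matrix m k ℂ, (PSDCompletion.block₃ A B Y C D E).PosSemidef →
        PSDCompletion.IsMaximalRank₃ (PSDCompletion.block₃ A B Y C D E) →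
        PSDCompletion.detPlus (PSDCompletion.block₃ A B Y C D E) ≤
          PSDCompletion.detPlus (PSDCompletion.block₃ A B X C D E)) ↔
    X = B * PSDCompletion.pinv C * D := by
  obtain ⟨hX₀, hX₀r⟩ :=
    PSDCompletion.posSemidef_and_isMaximalRank₃_block₃_pinv hα hαr hβ hβr
  constructor
  · rintro ⟨hX, hXr, hmax⟩
    by_contra hne
    exact (PSDCompletion.detPlus_block₃_lt hα hαr hβ hβr hX hXr hne).not_ge (hmax _ hX₀ hX₀r)
  · rintro rfl
    refine ⟨hX₀, hX₀r, fun Y hY hYr => ?_⟩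
    rcases eq_or_ne Y (B * PSDCompletion.pinv C * D) with rfl | hne
    · exact le_rfl
    · exact (PSDCompletion.detPlus_block₃_lt hα hαr hβ hβr hY hYr hne).le
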